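/- Conventions. For a commutative ring $R$ and $n\ge 0$, let $\mathcal F_{n}$ be the class of all $R$-modules of weak dimension at most $n$ (that is, having a flat resolution $0\to F_n\to\dots\to F_0\to M\to 0$), and let $(\mathcal F_{n})^{\intercal}$ be the class of all $R$-modules $D$ such that $\mathrm{Tor}_1^R(C,D)=0$ for each $C\in\mathcal F_{n}$. An $R$-module $M$ is *flat $n$-Mittag-Leffler* if $M$ is flat and, for each family $(Q_i\mid i\in I)$ of modules from $(\mathcal F_{n})^{\intercal}$, the canonical map $M\otimes_R\prod_{i\in I}Q_i\to\prod_{i\in I}M\otimes_R Q_i$, $m\otimes(q_i)_{i\in I}\mapsto(m\otimes q_i)_{i\in I}$, is injective. A quasi-coherent sheaf $\mathcal M$ on a scheme $X$ is an *$n$-Drinfeld vector bundle* if for each open affine set $u\subseteq X$, the $\mathcal O_X(u)$-module $\mathcal M(u)$ is flat $n$-Mittag-Leffler. Theorem. For each $n\ge 1$, the notion of an $n$-Drinfeld vector bundle is Zariski local on the class of all locally noetherian schemes. That is, let $X$ be a locally noetherian scheme, $X=\bigcup_{v\in V}v$ an open affine covering of $X$, and $\mathcal M$ a quasi-coherent sheaf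 on $X$. If the $\mathcal O_X(v)$-module $\mathcal M(v)$ is flat $n$-Mittag-Leffler for each $v\in V$, then $\mathcal M$ is an $n$-Drinfeld vector bundle. -/

import Mathlib

universe u

open CategoryTheory CategoryTheory.Limits AlgebraicGeometry

namespace RelativeMittagLeffler

/-- The class of `R`-modules of weak (flat) dimension at most `n`, i.e. of those modules `M` that
have a flat resolution `0 → F_n → ⋯ → F_0 → M → 0`. The resolution is built one step at a time:
`M` is flat, or `M` is a quotient of a flat module by a module with a shorter resolution. -/
def WeakDimLE (R : Type u) [CommRing R] : ℕ → ObjectProperty (ModuleCat.{u} R)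
  | 0 => fun M => Module.Flat R M
  | n + 1 => fun M => ∃ (F : ModuleCat.{u} R) (f : F →ₗ[R] M),
      Module.Flat R F ∧ Function.Surjective f ∧
        WeakDimLE R n (ModuleCat.of R (LinearMap.ker f))

/-- For a class `B` of modules, the class of all modules `D` with `Tor₁(C, D) = 0`
for each `C` in `B`. -/
def TorOrthogonal {R : Type u} [CommRing R] (B : ObjectProperty (ModuleCat.{u} R)) :
    ObjectProperty (ModuleCat.{u} R) :=
  fun D => ∀ C : ModuleCat.{u} R, B C → IsZero (((Tor (ModuleCat.{u} R) 1).obj C).obj D)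

/-- `M` is Mittag-Leffler relative to the class `Q`: for every family `(N i)` of members of `Q`,
the canonical map `M ⊗ ∏ N i → ∏ (M ⊗ N i)`, `m ⊗ (q i) ↦ (m ⊗ q i)`, is injective. -/
def IsMittagLefflerRel {R : Type u} [CommRing R] (Q : ObjectProperty (ModuleCat.{u} R)) :
    ObjectProperty (ModuleCat.{u} R) :=
  fun M => ∀ (I : Type u) (N : I → ModuleCat.{u} R), (∀ i, Q (N i)) →
    Function.Injective (TensorProduct.piRightHom R R M (fun i => (N i : Type u)))

/-- Flat `n`-Mittag-Leffler modules: flat modules that are Mittag-Leffler relative to the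
class of modules that are `Tor₁`-orthogonal to all modules of weak dimension at most `n`. -/
def IsFlatNMittagLeffler (n : ℕ) (R : CommRingCat.{u}) : ObjectProperty (ModuleCat.{u} R) :=
  fun M => Module.Flat R M ∧ IsMittagLefflerRel (TorOrthogonal (WeakDimLE R n)) M

/-- For a property `P` of modules over commutative rings, a sheaf of modules is locally
`P`-quasi-coherent if it is quasi-coherent and its sections on every open affine set
satisfy `P`. For `P = IsFlatNMittagLeffler n` these are the `n`-Drinfeld vector bundles. -/
structure IsLocallyQuasicoherent (P : ∀ R : CommRingCat.{u}, ObjectProperty (ModuleCat.{u} R))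
    {X : Scheme.{u}} (M : X.Modules) : Prop where
  isQuasicoherent : M.IsQuasicoherent
  sections : ∀ U : X.affineOpens, P Γ(X, U.1) (ModuleCat.of Γ(X, U.1) Γ(M, U.1))

/-- The notion of a locally `P`-quasi-coherent sheaf is Zariski local on the class `𝒞` of schemes:
a quasi-coherent sheaf on a member of `𝒞` is locally `P`-quasi-coherent as soon as its sections
satisfy `P` on the members of one open affine covering. -/
def IsZariskiLocalOn (P : ∀ R : CommRingCat.{u}, ObjectProperty (ModuleCat.{u} R))
    (𝒞 : ObjectProperty Scheme.{u}) : Prop :=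
  ∀ X : Scheme.{u}, 𝒞 X → ∀ V : Set X.affineOpens, (⨆ v ∈ V, (v : X.Opens)) = ⊤ →
    ∀ M : X.Modules, M.IsQuasicoherent →
      (∀ v ∈ V, P Γ(X, v.1) (ModuleCat.of Γ(X, v.1) Γ(M, v.1))) → IsLocallyQuasicoherent P M

end RelativeMittagLeffler

namespace RelativeMittagLeffler

/-! Locality on affine opens reduces to two statements about modules: the property passes from `R`
to a localization `R_f`, and it descends from finitely many `R_f` whose `f` generate the unit ideal.
For flat `R → S`, both extension and restriction of scalars preserve weak dimension at most `n`.
Since `Tor^S(C, S ⊗ N) = Tor^R(C, N)` and `Tor^R(C, N) = Tor^S(S ⊗ C, N)`, both also preserve the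
`Tor`-orthogonal class. Ascent: `(S ⊗ M) ⊗[S] Q = M ⊗[R] Q`, so the comparison map of `S ⊗ M` for a
family over `S` is that of `M` for the same family over `R`. Descent
(`isFlatNMittagLeffler_of_span`): an element killed by the comparison map of `M` dies in each `M ⊗ ∏
(S_r ⊗ N i)`. As `∏ N i` embeds in the finite product of the `∏ (S_r ⊗ N i)` and `M` is flat, the
element is zero. -/

open TensorProduct

/-! ### Vanishing of `Tor₁` by presentations -/

section TorOne

/-- Vanishing of `Tor₁(C, D)`, computed with flat presentations of `D`. -/
def TorOneVanishes (R : Type u) [CommRing R] (C D : Type u) [AddCommGroup C] [Module R C]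
    [AddCommGroup D] [Module R D] : Prop :=
  ∀ (L P : Type u) [AddCommGroup L] [Module R L] [AddCommGroup P] [Module R P]
    (i : L →ₗ[R] P) (f : P →ₗ[R] D), Function.Injective i → Function.Exact i f →
    Function.Surjective f → Module.Flat R P → Function.Injective (i.lTensor C)

section Balance

variable {R : Type*} [CommRing R] {K F C L P D : Type*}
  [AddCommGroup K] [Module R K] [AddCommGroup F] [Module R F] [AddCommGroup C] [Module R C]
  [AddCommGroup L] [Module R L] [AddCommGroup P] [Module R P] [AddCommGroup D] [Module R D]

/-- Half of the balancing of `Tor₁`: a diagram chase on the tensor product of two presentations. -/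
lemma rTensor_injective_of_lTensor_injective [Module.Flat R P]
    {j : K →ₗ[R] F} {g : F →ₗ[R] C} (hj : Function.Injective j) (hjg : Function.Exact j g)
    (hg : Function.Surjective g) {i : L →ₗ[R] P} {f : P →ₗ[R] D} (hif : Function.Exact i f)
    (hf : Function.Surjective f) (h : Function.Injective (i.lTensor C)) :
    Function.Injective (j.rTensor D) := by
  rw [injective_iff_map_eq_zero]
  intro x hx
  obtain ⟨y, rfl⟩ := LinearMap.lTensor_surjective K hf x
  have hy : f.lTensor F (j.rTensor P y) = 0 := by
    rw [← hx, ← LinearMap.comp_apply, ← LinearMap.comp_apply, LinearMap.lTensor_comp_rTensor,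
      LinearMap.rTensor_comp_lTensor]
  obtain ⟨z, hz⟩ := (lTensor_exact F hif hf _).1 hy
  have hz0 : g.rTensor L z = 0 := by
    apply h
    rw [map_zero, ← LinearMap.comp_apply, LinearMap.lTensor_comp_rTensor,
      ← LinearMap.rTensor_comp_lTensor, LinearMap.comp_apply, hz]
    exact (rTensor_exact P hjg hg).apply_apply_eq_zero y
  obtain ⟨w, rfl⟩ := (rTensor_exact L hjg hg _).1 hz0
  have hw : i.lTensor K w = y := by
    apply Module.Flat.rTensor_preserves_injective_linearMap (M := P) j hj
    rw [← hz, ← LinearMap.comp_apply, ← LinearMap.comp_apply, LinearMap.lTensor_comp_rTensor,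
      LinearMap.rTensor_comp_lTensor]
  rw [← hw]
  exact (lTensor_exact K hif hf).apply_apply_eq_zero w

lemma lTensor_injective_of_rTensor_injective [Module.Flat R F]
    {j : K →ₗ[R] F} {g : F →ₗ[R] C} (hjg : Function.Exact j g)
    (hg : Function.Surjective g) {i : L →ₗ[R] P} {f : P →ₗ[R] D} (hi : Function.Injective i)
    (hif : Function.Exact i f) (hf : Function.Surjective f)
    (h : Function.Injective (j.rTensor D)) : Function.Injective (i.lTensor C) := by
  rw [LinearMap.lTensor_inj_iff_rTensor_inj]
  exact rTensor_injective_of_lTensor_injective hi hif hf hjg hg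
    ((LinearMap.lTensor_inj_iff_rTensor_inj _ _).2 h)

end Balance

variable {R : Type u} [CommRing R]

/-- One presentation of `D` suffices: pass to a free presentation of `C` and back by balancing.
Injectivity of `i` is not required, so right exactness is enough when this is applied after base
change. -/
lemma torOneVanishes_of_injective {C D L P : Type u} [AddCommGroup C] [Module R C]
    [AddCommGroup D] [Module R D] [AddCommGroup L] [Module R L] [AddCommGroup P] [Module R P]
    [Module.Flat R P] {i : L →ₗ[R] P} {f : P →ₗ[R] D} (hif : Function.Exact i f)
    (hf : Function.Surjective f) (h : Function.Injective (i.lTensor C)) :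
    TorOneVanishes R C D := by
  intro L' P' _ _ _ _ i' f' hi' hif' hf' _
  let g : (C →₀ R) →ₗ[R] C := Finsupp.linearCombination R id
  have hg : Function.Surjective g := Finsupp.linearCombination_id_surjective R C
  exact lTensor_injective_of_rTensor_injective (LinearMap.exact_subtype_ker_map g) hg hi' hif' hf'
    (rTensor_injective_of_lTensor_injective (Submodule.subtype_injective _)
      (LinearMap.exact_subtype_ker_map g) hg hif hf h)

/-- Translates injectivity on a syzygy `L` into exactness in degree one of a tensored resolution. -/
lemma lTensor_injective_iff_exact {A B L P : Type*} (C : Type*) [AddCommGroup C] [Module R C]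
    [AddCommGroup A] [Module R A] [AddCommGroup B] [Module R B] [AddCommGroup L] [Module R L]
    [AddCommGroup P] [Module R P] {a : A →ₗ[R] B} {b : B →ₗ[R] L} (i : L →ₗ[R] P)
    (hab : Function.Exact a b) (hb : Function.Surjective b) :
    Function.Injective (i.lTensor C) ↔
      Function.Exact (a.lTensor C) ((i ∘ₗ b).lTensor C) := by
  have hex := lTensor_exact C hab hb
  have hsurj := LinearMap.lTensor_surjective C hb
  rw [LinearMap.lTensor_comp]
  constructor
  · intro h x
    rw [← hex x, LinearMap.comp_apply, map_eq_zero_iff _ h]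
  · intro h
    rw [injective_iff_map_eq_zero]
    intro x hx
    obtain ⟨y, rfl⟩ := hsurj x
    exact (hex y).2 ((h y).1 hx)

lemma isZero_tor_one_iff (C D : ModuleCat.{u} R) :
    IsZero (((Tor (ModuleCat.{u} R) 1).obj C).obj D) ↔ TorOneVanishes R C D := by
  let Q := projectiveResolution D
  have hflat : Module.Flat R (Q.complex.X 0) := by
    have := IsProjective.iff_projective (R := R) (P := Q.complex.X 0) |>.2 (Q.projective 0)
    infer_instance
  let π : Q.complex.X 0 →ₗ[R] D := (Q.π.f 0).hom
  have hπ : Function.Surjective π := (ModuleCat.epi_iff_surjective (Q.π.f 0)).1 inferInstance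
  have h₀ : Function.Exact (Q.complex.d 1 0).hom π :=
    (ShortComplex.ShortExact.moduleCat_exact_iff_function_exact _).1 Q.exact₀
  have h₁ : Function.Exact (Q.complex.d 2 1).hom (Q.complex.d 1 0).hom :=
    (ShortComplex.ShortExact.moduleCat_exact_iff_function_exact _).1 (Q.exact_succ 0)
  let L := LinearMap.ker π
  let b : Q.complex.X 1 →ₗ[R] L := (Q.complex.d 1 0).hom.codRestrict L
    fun x => h₀.apply_apply_eq_zero x
  have hb : Function.Surjective b := fun ⟨x, hx⟩ => by
    obtain ⟨y, hy⟩ := (h₀ x).1 hx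
    exact ⟨y, Subtype.ext hy⟩
  have hab : Function.Exact (Q.complex.d 2 1).hom b := fun x => by
    rw [← h₁ x, ← Subtype.coe_inj]; rfl
  have key := lTensor_injective_iff_exact C L.subtype hab hb
  have e := Q.isoLeftDerivedObj ((MonoidalCategory.tensoringLeft _).obj C) 1
  have : IsZero (((Tor (ModuleCat.{u} R) 1).obj C).obj D) ↔
      Function.Injective (L.subtype.lTensor C) := by
    rw [key]
    refine (e.isZero_iff).trans ?_
    refine (HomologicalComplex.exactAt_iff_isZero_homology _ _).symm.trans ?_
    rw [HomologicalComplex.exactAt_iff' _ 2 1 0 (by simp) (by simp)]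
    exact ShortComplex.ShortExact.moduleCat_exact_iff_function_exact _
  rw [this]
  exact ⟨torOneVanishes_of_injective (LinearMap.exact_subtype_ker_map π) hπ,
    fun h => h _ _ _ π L.injective_subtype (LinearMap.exact_subtype_ker_map π) hπ hflat⟩

end TorOne

/-! ### Change of rings for `Tor₁` -/

section BaseChange

lemma exists_free_presentation (R : Type u) [CommRing R] (N : Type u) [AddCommGroup N]
    [Module R N] :
    ∃ (L P : Type u) (_ : AddCommGroup L) (_ : Module R L) (_ : AddCommGroup P) (_ : Module R P)
      (i : L →ₗ[R] P) (f : P →ₗ[R] N), Function.Injective i ∧ Function.Exact i f ∧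
        Function.Surjective f ∧ Module.Free R P :=
  ⟨LinearMap.ker (Finsupp.linearCombination R (id : N → N)), N →₀ R, inferInstance, inferInstance,
    inferInstance, inferInstance, Submodule.subtype _, Finsupp.linearCombination R id,
    Submodule.subtype_injective _, LinearMap.exact_subtype_ker_map _,
    Finsupp.linearCombination_id_surjective R N, inferInstance⟩

variable {R S : Type u} [CommRing R] [CommRing S] [Algebra R S]

/-- Tensoring a free presentation of `N` with `S` presents `S ⊗ N`, and `C ⊗[S] (S ⊗[R] i)` is `C
⊗[R] i`. -/
lemma TorOneVanishes.baseChange {C N : Type u} [AddCommGroup C] [Module R C] [Module S C]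
    [IsScalarTower R S C] [AddCommGroup N] [Module R N] (h : TorOneVanishes R C N) :
    TorOneVanishes S C (S ⊗[R] N) := by
  obtain ⟨L, P, _, _, _, _, i, f, hi, hif, hf, _⟩ := exists_free_presentation R N
  refine torOneVanishes_of_injective (i := i.baseChange S) (f := f.baseChange S)
    (lTensor_exact S hif hf) (LinearMap.lTensor_surjective S hf) ?_
  let e₁ := AlgebraTensorModule.cancelBaseChange R S S C L
  let e₂ := AlgebraTensorModule.cancelBaseChange R S S C P
  have hcomm : e₂.toLinearMap ∘ₗ (i.baseChange S).lTensor C =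
      AlgebraTensorModule.lTensor S C i ∘ₗ e₁.toLinearMap := by
    ext; simp [e₁, e₂]
  have : Function.Injective (e₂.toLinearMap ∘ₗ (i.baseChange S).lTensor C) := by
    rw [hcomm]
    exact (h L P i f hi hif hf inferInstance).comp e₁.injective
  rw [LinearMap.coe_comp] at this
  exact this.of_comp

/-- A free `S`-module is flat over `R`, so an `S`-free presentation of `N` also computes `Tor` over
`R`. -/
lemma TorOneVanishes.restrictScalars [Module.Flat R S] {C N : Type u} [AddCommGroup C]
    [Module R C] [AddCommGroup N] [Module R N] [Module S N] [IsScalarTower R S N]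
    (h : TorOneVanishes S (S ⊗[R] C) N) : TorOneVanishes R C N := by
  obtain ⟨L, P, _, _, _, _, i, f, hi, hif, hf, _⟩ := exists_free_presentation S N
  have hinj := h L P i f hi hif hf inferInstance
  rw [LinearMap.lTensor_inj_iff_rTensor_inj] at hinj
  let _ : Module R L := Module.compHom L (algebraMap R S)
  let _ : Module R P := Module.compHom P (algebraMap R S)
  have : IsScalarTower R S L := .of_algebraMap_smul fun _ _ => rfl
  have : IsScalarTower R S P := .of_algebraMap_smul fun _ _ => rfl
  have : Module.Flat R P := Module.Flat.trans R S P
  refine torOneVanishes_of_injective (i := i.restrictScalars R) (f := f.restrictScalars R)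
    hif hf ?_
  rw [LinearMap.lTensor_inj_iff_rTensor_inj]
  let e₁ := AlgebraTensorModule.cancelBaseChange R S S L C
  let e₂ := AlgebraTensorModule.cancelBaseChange R S S P C
  have hcomm : (AlgebraTensorModule.rTensor R C i) ∘ₗ e₁.toLinearMap =
      e₂.toLinearMap ∘ₗ i.rTensor (S ⊗[R] C) := by
    ext; simp [e₁, e₂]
  have : Function.Injective ((AlgebraTensorModule.rTensor R C i) ∘ₗ e₁.toLinearMap) := by
    rw [hcomm]
    exact e₂.injective.comp hinj
  exact (Function.Injective.of_comp_iff' _ e₁.bijective).1 this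

end BaseChange

/-! ### Weak dimension and orthogonal classes under flat ring maps -/

section WeakDim

variable {R : Type u} [CommRing R]

lemma WeakDimLE.of_linearEquiv {n : ℕ} {M N : ModuleCat.{u} R} (e : M ≃ₗ[R] N)
    (h : WeakDimLE R n M) : WeakDimLE R n N := by
  cases n with
  | zero =>
    have : Module.Flat R M := h
    exact Module.Flat.of_linearEquiv e.symm
  | succ n =>
    obtain ⟨F, f, hF, hf, hk⟩ := h
    refine ⟨F, e.toLinearMap ∘ₗ f, hF, e.surjective.comp hf, ?_⟩
    rwa [LinearEquiv.ker_comp]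

lemma weakDimLE_succ_of_exact {n : ℕ} {L F M : Type u} [AddCommGroup L] [Module R L]
    [AddCommGroup F] [Module R F] [AddCommGroup M] [Module R M] (i : L →ₗ[R] F) (f : F →ₗ[R] M)
    (hi : Function.Injective i) (hif : Function.Exact i f) (hf : Function.Surjective f)
    [hF : Module.Flat R F] (hL : WeakDimLE R n (ModuleCat.of R L)) :
    WeakDimLE R (n + 1) (ModuleCat.of R M) := by
  refine ⟨ModuleCat.of R F, f, hF, hf, WeakDimLE.of_linearEquiv ?_ hL⟩
  exact (LinearEquiv.ofInjective i hi).trans (LinearEquiv.ofEq _ _ hif.linearMap_ker_eq.symm)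

variable {S : Type u} [CommRing S] [Algebra R S] [Module.Flat R S]

lemma WeakDimLE.restrictScalars (n : ℕ) (M : Type u) [AddCommGroup M] [Module R M] [Module S M]
    [IsScalarTower R S M] (h : WeakDimLE S n (ModuleCat.of S M)) :
    WeakDimLE R n (ModuleCat.of R M) := by
  induction n generalizing M with
  | zero =>
    have : Module.Flat S M := h
    exact Module.Flat.trans R S M
  | succ n ih =>
    obtain ⟨F, f, hF, hf, hk⟩ := h
    let _ : Module R F := Module.compHom F (algebraMap R S)
    have : IsScalarTower R S F := .of_algebraMap_smul fun _ _ => rfl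
    have : Module.Flat R F := Module.Flat.trans R S F
    exact weakDimLE_succ_of_exact ((LinearMap.ker f).subtype.restrictScalars R)
      (f.restrictScalars R) (LinearMap.ker f).injective_subtype
      (LinearMap.exact_subtype_ker_map f) hf (ih _ hk)

lemma WeakDimLE.baseChange (n : ℕ) (M : Type u) [AddCommGroup M] [Module R M]
    (h : WeakDimLE R n (ModuleCat.of R M)) :
    WeakDimLE S n (ModuleCat.of S (S ⊗[R] M)) := by
  induction n generalizing M with
  | zero =>
    have : Module.Flat R M := h
    exact inferInstanceAs (Module.Flat S (S ⊗[R] M))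
  | succ n ih =>
    obtain ⟨F, f, hF, hf, hk⟩ := h
    exact weakDimLE_succ_of_exact ((LinearMap.ker f).subtype.baseChange S) (f.baseChange S)
      (Module.Flat.lTensor_preserves_injective_linearMap _ (LinearMap.ker f).injective_subtype)
      (lTensor_exact S (LinearMap.exact_subtype_ker_map f) hf)
      (LinearMap.lTensor_surjective S hf) (ih _ hk)

/-- The variance is crossed: extending `N` needs restriction of the test modules `C`, and
restricting `N` needs their extension. -/
lemma TorOrthogonal.baseChange {n : ℕ} {N : Type u} [AddCommGroup N] [Module R N]
    (h : TorOrthogonal (WeakDimLE R n) (ModuleCat.of R N)) :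
    TorOrthogonal (WeakDimLE S n) (ModuleCat.of S (S ⊗[R] N)) := by
  intro C hC
  let _ : Module R C := Module.compHom C (algebraMap R S)
  have : IsScalarTower R S C := .of_algebraMap_smul fun _ _ => rfl
  rw [isZero_tor_one_iff]
  exact ((isZero_tor_one_iff _ _).1 (h _ (WeakDimLE.restrictScalars n C hC))).baseChange

lemma TorOrthogonal.restrictScalars {n : ℕ} {N : Type u} [AddCommGroup N] [Module R N]
    [Module S N] [IsScalarTower R S N]
    (h : TorOrthogonal (WeakDimLE S n) (ModuleCat.of S N)) :
    TorOrthogonal (WeakDimLE R n) (ModuleCat.of R N) := by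
  intro C hC
  rw [isZero_tor_one_iff]
  exact ((isZero_tor_one_iff _ _).1 (h _ (WeakDimLE.baseChange n C hC))).restrictScalars

end WeakDim

/-! ### Comparison maps under change of modules and rings -/

section MittagLeffler

variable {R : Type u} [CommRing R]

lemma piRightHom_rTensor {M M' : Type*} [AddCommGroup M] [Module R M] [AddCommGroup M']
    [Module R M'] (g : M →ₗ[R] M') {I : Type*} (N : I → Type*) [∀ i, AddCommGroup (N i)]
    [∀ i, Module R (N i)] (x : M ⊗[R] (∀ i, N i)) (i : I) :
    piRightHom R R M' N (g.rTensor _ x) i = g.rTensor _ (piRightHom R R M N x i) := by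
  induction x with
  | zero => simp
  | tmul m f => simp
  | add x y hx hy => simp [hx, hy]

lemma IsMittagLefflerRel.of_linearEquiv {Q : ObjectProperty (ModuleCat.{u} R)}
    {M M' : ModuleCat.{u} R} (e : M ≃ₗ[R] M') (h : IsMittagLefflerRel Q M) :
    IsMittagLefflerRel Q M' := by
  intro I N hN
  have hinj : Function.Injective (e.symm.toLinearMap.rTensor (∀ i, N i)) :=
    (e.symm.rTensor (∀ i, N i)).injective
  rw [injective_iff_map_eq_zero]
  intro x hx
  apply hinj
  apply h I N hN
  ext i
  rw [map_zero, map_zero]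
  exact (piRightHom_rTensor _ _ x i).trans (by rw [hx]; simp)

variable {S : Type u} [CommRing S] [Algebra R S]

/-- The identification `(S ⊗ M) ⊗[S] Q ≃ M ⊗[R] Q`. -/
noncomputable def baseChangeTensorEquiv (R S M Q : Type u) [CommRing R] [CommRing S] [Algebra R S]
    [AddCommGroup M] [Module R M] [AddCommGroup Q] [Module R Q] [Module S Q]
    [IsScalarTower R S Q] : (S ⊗[R] M) ⊗[S] Q ≃+ M ⊗[R] Q :=
  (TensorProduct.comm S (S ⊗[R] M) Q).toAddEquiv.trans <|
    (AlgebraTensorModule.cancelBaseChange R S S Q M).toAddEquiv.trans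
      (TensorProduct.comm R Q M).toAddEquiv

lemma baseChangeTensorEquiv_tmul (M Q : Type u) [AddCommGroup M] [Module R M] [AddCommGroup Q]
    [Module R Q] [Module S Q] [IsScalarTower R S Q] (s : S) (m : M) (q : Q) :
    baseChangeTensorEquiv R S M Q ((s ⊗ₜ m) ⊗ₜ q) = m ⊗ₜ (s • q) := by
  simp [baseChangeTensorEquiv]

lemma baseChangeTensorEquiv_piRightHom (M : Type u) [AddCommGroup M] [Module R M] {I : Type u}
    (N : I → Type u) [∀ i, AddCommGroup (N i)] [∀ i, Module R (N i)] [∀ i, Module S (N i)]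
    [∀ i, IsScalarTower R S (N i)] (x : (S ⊗[R] M) ⊗[S] (∀ i, N i)) (i : I) :
    baseChangeTensorEquiv R S M (N i) (piRightHom S S (S ⊗[R] M) N x i) =
      piRightHom R R M N (baseChangeTensorEquiv R S M (∀ i, N i) x) i := by
  induction x with
  | zero => simp
  | add x y hx hy => simp [hx, hy]
  | tmul y f =>
    induction y with
    | zero => simp
    | add x y hx hy => simp only [add_tmul, map_add, Pi.add_apply, hx, hy]
    | tmul s m => simp [baseChangeTensorEquiv_tmul]

variable [Module.Flat R S]

lemma IsFlatNMittagLeffler.baseChange {n : ℕ} {M : Type u} [AddCommGroup M] [Module R M]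
    (h : IsFlatNMittagLeffler n (.of R) (ModuleCat.of R M)) :
    IsFlatNMittagLeffler n (.of S) (ModuleCat.of S (S ⊗[R] M)) := by
  have : Module.Flat R M := h.1
  refine ⟨inferInstanceAs (Module.Flat S (S ⊗[R] M)), fun I N hN => ?_⟩
  let _ : ∀ i, Module R (N i) := fun i => Module.compHom (N i) (algebraMap R S)
  have : ∀ i, IsScalarTower R S (N i) := fun i => .of_algebraMap_smul fun _ _ => rfl
  have hinj := h.2 I (fun i => ModuleCat.of R (N i)) fun i =>
    TorOrthogonal.restrictScalars (S := S) (hN i)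
  intro x y hxy
  apply (baseChangeTensorEquiv R S M (∀ i, N i)).injective
  apply hinj
  ext i
  exact (baseChangeTensorEquiv_piRightHom M (fun i => N i) x i).symm.trans
    ((congr_arg (baseChangeTensorEquiv R S M (N i)) (congr_fun hxy i)).trans
      (baseChangeTensorEquiv_piRightHom M (fun i => N i) y i))

lemma piRightHom_lTensor {M : Type*} [AddCommGroup M] [Module R M] {I : Type*} {N N' : I → Type*}
    [∀ i, AddCommGroup (N i)] [∀ i, Module R (N i)] [∀ i, AddCommGroup (N' i)]
    [∀ i, Module R (N' i)] (g : ∀ i, N i →ₗ[R] N' i) (x : M ⊗[R] (∀ i, N i)) (i : I) :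
    piRightHom R R M N' ((LinearMap.pi fun i => g i ∘ₗ LinearMap.proj i).lTensor M x) i =
      (g i).lTensor M (piRightHom R R M N x i) := by
  induction x with
  | zero => simp
  | tmul m f => simp
  | add x y hx hy => simp [hx, hy]

/-- If `M` becomes flat `n`-Mittag-Leffler over the flat algebra `S`, then the kernel of the
comparison map for `M` dies in `M ⊗ ∏ (S ⊗ N i)`. -/
lemma IsFlatNMittagLeffler.lTensor_eq_zero {n : ℕ} {M : Type u} [AddCommGroup M] [Module R M]
    (h : IsFlatNMittagLeffler n (.of S) (ModuleCat.of S (S ⊗[R] M))) {I : Type u}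
    (N : I → ModuleCat.{u} R) (hN : ∀ i, TorOrthogonal (WeakDimLE R n) (N i))
    {x : M ⊗[R] (∀ i, N i)} (hx : piRightHom R R M (fun i => (N i : Type u)) x = 0) :
    (LinearMap.pi fun i => TensorProduct.mk R S (N i) 1 ∘ₗ LinearMap.proj i).lTensor M x = 0 := by
  have hinj := h.2 I (fun i => ModuleCat.of S (S ⊗[R] N i)) fun i =>
    TorOrthogonal.baseChange (hN i)
  let e := baseChangeTensorEquiv R S M (∀ i, S ⊗[R] N i)
  rw [← map_eq_zero_iff e.symm e.symm.injective]
  apply hinj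
  rw [map_zero]
  ext i
  apply (baseChangeTensorEquiv R S M (S ⊗[R] N i)).injective
  refine (baseChangeTensorEquiv_piRightHom M (fun i => S ⊗[R] N i) _ i).trans ?_
  rw [e.apply_symm_apply]
  refine (piRightHom_lTensor (fun i => TensorProduct.mk R S (N i) 1) x i).trans ?_
  rw [hx]
  simp

end MittagLeffler

/-! ### Descent along a finite cover by localizations -/

section Localization

variable {R : Type u} [CommRing R]

lemma isFlatNMittagLeffler_of_span {n : ℕ} {M : Type u} [AddCommGroup M] [Module R M]
    (s : Finset R) (hs : Ideal.span (s : Set R) = ⊤) (S : s → Type u) [∀ r, CommRing (S r)]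
    [∀ r, Algebra R (S r)] [∀ r : s, IsLocalization.Away (r : R) (S r)]
    (h : ∀ r, IsFlatNMittagLeffler n (.of (S r)) (ModuleCat.of (S r) (S r ⊗[R] M))) :
    IsFlatNMittagLeffler n (.of R) (ModuleCat.of R M) := by
  have (r : s) : Module.Flat R (S r) := IsLocalization.flat _ (.powers (r : R))
  have hM : Module.Flat R M := by
    refine Module.flat_of_isLocalized_span R M (s : Set R) hs
      (fun r => S r ⊗[R] M) (fun r => TensorProduct.mk R (S r) M 1) fun r => ?_
    have : Module.Flat (S r) (S r ⊗[R] M) := (h r).1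
    exact Module.Flat.trans R (S r) _
  classical
  refine ⟨hM, fun I N hN => ?_⟩
  rw [injective_iff_map_eq_zero]
  intro x hx
  let φ (r : s) : (∀ i, N i) →ₗ[R] ∀ i, S r ⊗[R] N i :=
    LinearMap.pi fun i => TensorProduct.mk R (S r) (N i) 1 ∘ₗ LinearMap.proj i
  have hφ : Function.Injective (LinearMap.pi φ) := by
    intro a b hab
    ext i
    refine Module.eq_of_isLocalized_span (s : Set R) hs (fun r => S r ⊗[R] N i)
      (fun r => TensorProduct.mk R (S r) (N i) 1) _ _ fun r => ?_
    exact congr_fun (congr_fun hab r) i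
  apply Module.Flat.lTensor_preserves_injective_linearMap (M := M) _ hφ
  -- Finiteness of `s` makes `M ⊗ -` commute with the product over `s`, so each component can be
  -- checked separately.
  apply (TensorProduct.piRight R R M (fun r : s => ∀ i, S r ⊗[R] N i)).injective
  rw [map_zero, map_zero]
  ext r : 1
  have key : TensorProduct.piRight R R M (fun r : s => ∀ i, S r ⊗[R] N i)
      ((LinearMap.pi φ).lTensor M x) r = (φ r).lTensor M x := by
    have : LinearMap.proj r ∘ₗ
        (TensorProduct.piRight R R M (fun r : s => ∀ i, S r ⊗[R] N i)).toLinearMap ∘ₗ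
        (LinearMap.pi φ).lTensor M = (φ r).lTensor M := by
      ext; simp
    exact LinearMap.congr_fun this x
  exact key.trans ((h r).lTensor_eq_zero N hN hx)

end Localization

/-! ### Sections of quasi-coherent sheaves over basic opens -/

section Sheaf

variable {X : Scheme.{u}} (M : X.Modules)

lemma fromSpec_appIso_inv {U : X.Opens} (hU : IsAffineOpen U) (T : (Spec Γ(X, U)).Opens)
    (hT : hU.fromSpec ''ᵁ T ≤ U) :
    (Scheme.ΓSpecIso Γ(X, U)).inv ≫ (Spec Γ(X, U)).presheaf.map T.leTop.op ≫
      (hU.fromSpec.appIso T).inv = X.presheaf.map (homOfLE hT).op := by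
  rw [← Category.assoc, Iso.comp_inv_eq, Scheme.Hom.appIso_hom', Scheme.Hom.map_appLE,
    Scheme.Hom.appLE, hU.fromSpec_app_self, Category.assoc, ← Functor.map_comp]
  rfl

lemma restrictAppIso_fromSpec_smul {U : X.Opens} (hU : IsAffineOpen U)
    (T : (Spec Γ(X, U)).Opens) (hT : hU.fromSpec ''ᵁ T ≤ U) (r : Γ(X, U))
    (z : Γ(M.restrict hU.fromSpec, T)) :
    (M.restrictAppIso hU.fromSpec T).hom (r • z) = X.presheaf.map (homOfLE hT).op r •
        (M.restrictAppIso hU.fromSpec T).hom z := by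
  have h := congr($(M.smul_restrictAppIso_hom hU.fromSpec T
    ((Spec Γ(X, U)).presheaf.map T.leTop.op ((Scheme.ΓSpecIso Γ(X, U)).inv r))) z)
  rw [← fromSpec_appIso_inv hU T hT]
  exact h

/-- The localization property is known on `Spec Γ(X, U)`, whose opens map to `U` and `X.basicOpen f`
only up to propositional equality. Free variables `W` and `V` let these equalities be substituted
away. -/
lemma exists_map_eq_pow_smul [M.IsQuasicoherent] {U : X.Opens} (hU : IsAffineOpen U)
    (f : Γ(X, U)) (W V : X.Opens) (hW : W = U) (hV : V = X.basicOpen f) (hVW : V ≤ W)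
    (hWU : W ≤ U) (hVU : V ≤ U) :
    (∀ y : Γ(M, V), ∃ (k : ℕ) (x : Γ(M, W)),
      X.presheaf.map (homOfLE hVU).op (f ^ k) • y = M.presheaf.map (homOfLE hVW).op x) ∧
    (∀ x : Γ(M, W), M.presheaf.map (homOfLE hVW).op x = 0 →
      ∃ k : ℕ, X.presheaf.map (homOfLE hWU).op (f ^ k) • x = 0) := by
  have hW' : hU.fromSpec ''ᵁ ⊤ = W := by simp [hW]
  have hV' : hU.fromSpec ''ᵁ (PrimeSpectrum.basicOpen f) = V := by
    rw [hV, hU.fromSpec_image_basicOpen]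
  subst hW' hV'
  have h := (isIso_fromTildeΓ_iff_isLocalizing (M.restrict hU.fromSpec)).1 inferInstance f
  have hs (T : (Spec Γ(X, U)).Opens) (hT : hU.fromSpec ''ᵁ T ≤ U) (r : Γ(X, U))
      (z : Γ(M.restrict hU.fromSpec, T)) :
      r • z = X.presheaf.map (homOfLE hT).op r •
        (M.restrictAppIso hU.fromSpec T).hom z := by
    exact restrictAppIso_fromSpec_smul M hU T hT r z
  constructor
  · intro y
    obtain ⟨⟨x, ⟨_, k, rfl⟩⟩, hx⟩ := h.surj y
    exact ⟨k, x, (hs _ hVU _ y).symm.trans hx⟩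
  · intro x hx
    obtain ⟨⟨_, k, rfl⟩, hk⟩ := h.exists_of_eq (x₁ := x) (x₂ := 0) (by rw [map_zero]; exact hx)
    refine ⟨k, (hs _ hWU _ x).symm.trans (hk.trans (smul_zero _))⟩

end Sheaf

lemma IsFlatNMittagLeffler.of_linearEquiv {n : ℕ} {R : CommRingCat.{u}} {M M' : ModuleCat.{u} R}
    (e : M ≃ₗ[R] M') (h : IsFlatNMittagLeffler n R M) : IsFlatNMittagLeffler n R M' := by
  have : Module.Flat R M := h.1
  exact ⟨Module.Flat.of_linearEquiv e.symm, h.2.of_linearEquiv e⟩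

lemma nonempty_baseChange_sections_equiv {X : Scheme.{u}} (M : X.Modules) [M.IsQuasicoherent]
    {U : X.Opens} (hU : IsAffineOpen U) (f : Γ(X, U)) :
    Nonempty ((Γ(X, X.basicOpen f) ⊗[Γ(X, U)] Γ(M, U)) ≃ₗ[Γ(X, X.basicOpen f)]
      Γ(M, X.basicOpen f)) := by
  have hle := X.basicOpen_le f
  have := hU.isLocalization_basicOpen f
  let _ : Module Γ(X, U) Γ(M, X.basicOpen f) :=
    Module.compHom _ (algebraMap Γ(X, U) Γ(X, X.basicOpen f))
  have : IsScalarTower Γ(X, U) Γ(X, X.basicOpen f) Γ(M, X.basicOpen f) :=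
    .of_algebraMap_smul fun _ _ => rfl
  let ρ : Γ(M, U) →ₗ[Γ(X, U)] Γ(M, X.basicOpen f) :=
    { toFun := M.presheaf.map (homOfLE hle).op
      map_add' := map_add _
      map_smul' := fun r x => M.map_smul (homOfLE hle) r x }
  obtain ⟨hsurj, hinj⟩ := exists_map_eq_pow_smul M hU f U _ rfl rfl hle le_rfl hle
  have : IsLocalizedModule.Away f ρ := by
    refine .mk_of_addCommGroup ?_ hsurj fun x hx => ?_
    · have := (IsLocalization.Away.algebraMap_isUnit (S := Γ(X, X.basicOpen f)) f).map
        (algebraMap _ (Module.End Γ(X, X.basicOpen f) Γ(M, X.basicOpen f)))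
      rw [Module.End.isUnit_iff] at this ⊢
      exact this
    · obtain ⟨k, hk⟩ := hinj x hx
      refine ⟨k, Eq.trans ?_ hk⟩
      -- `hinj` makes the scalar act through restriction along `U ≤ U`, which is the identity.
      congr 1
      exact congr($(X.presheaf.map_id (.op U)) (f ^ k)).symm
  exact ⟨(IsLocalizedModule.isBaseChange (.powers f) Γ(X, X.basicOpen f) ρ).equiv⟩

end RelativeMittagLeffler

open RelativeMittagLeffler in
/-- Being an `n`-Drinfeld vector bundle is a Zariski local notion. The argument only uses that
localizations are flat, so neither `1 ≤ n` nor the noetherian hypothesis enters. -/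
theorem theorem4p6 (n : ℕ) (hn : 1 ≤ n) :
    RelativeMittagLeffler.IsZariskiLocalOn.{u} (RelativeMittagLeffler.IsFlatNMittagLeffler n)
      (fun X : Scheme.{u} => IsLocallyNoetherian X) := by
  intro X _ V hV M hM h
  refine ⟨hM, fun U => ?_⟩
  induction U using of_affine_open_cover (fun v : V => v.1) (by rw [← hV, iSup_subtype]) with
  | basicOpen U f hU =>
    obtain ⟨e⟩ := nonempty_baseChange_sections_equiv M U.2 f
    have := U.2.isLocalization_basicOpen f
    have : Module.Flat Γ(X, U) Γ(X, X.basicOpen f) := IsLocalization.flat _ (.powers f)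
    exact IsFlatNMittagLeffler.of_linearEquiv e
      (IsFlatNMittagLeffler.baseChange (R := Γ(X, U)) (S := Γ(X, X.basicOpen f)) hU)
  | openCover U s hs hU =>
    have := fun f : s => U.2.isLocalization_basicOpen f.1
    refine isFlatNMittagLeffler_of_span s hs (fun f => Γ(X, X.basicOpen f.1)) fun f => ?_
    obtain ⟨e⟩ := nonempty_baseChange_sections_equiv M U.2 f.1
    exact IsFlatNMittagLeffler.of_linearEquiv e.symm (hU f)
  | hU v => exact h v.1 v.2
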